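/- Let $n \ge 4$ and let $d = (d_1, \ldots, d_n)$ be a degree sequence, that is, a sequence of integers with $n-1 \ge d_1 \ge d_2 \ge \cdots \ge d_n \ge 1$ whose sum $\sum_i d_i$ is even. Put $m = \frac12 \sum_i d_i$, let $\mu_1$ be the number of indices $i$ with $d_i = 1$, let $\mu_{\mathrm{odd}}$ be the number of indices $i$ such that $d_i$ is odd and $d_i > 1$, and let $$\beta = \max\left\{\mu_1,\ \tfrac12(\mu_1 + \mu_{\mathrm{odd}})\right\}.$$ A bi-cactus (bipartite cactus) is a connected bipartite simple graph in which every edge lies on at most one cycle. Theorem. Suppose that $d_4 \ge 2$, $\sum_i d_i > 2n$ and $\mu_1 + \mu_{\mathrm{odd}} \ge 2$. Then there is a bi-cactus $G$ on the vertex set $\{1, \ldots, n\}$ with $\deg_G(i) = d_i$ for all $i$ if and only if $$m \le \left\lfloor \frac{4(n-1) - \beta}{3} \right\rfloor.$$ -/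

import Mathlib

namespace BiCactus

/-- A degree sequence of length `n`: a non-increasing sequence of integers from `{1, …, n - 1}`
with even volume. -/
structure IsDegreeSequence {n : ℕ} (d : Fin n → ℕ) : Prop where
  antitone : Antitone d
  pos : ∀ i, 1 ≤ d i
  lt : ∀ i, d i < n
  even_sum : Even (∑ i, d i)

/-- The number `m = (∑ d_i) / 2`, as a rational number. -/
def halfVolume {n : ℕ} (d : Fin n → ℕ) : ℚ :=
  (∑ i, (d i : ℚ)) / 2

/-- The multiplicity of `1` in `d`. -/
def multOne {n : ℕ} (d : Fin n → ℕ) : ℕ :=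
  (Finset.univ.filter fun i => d i = 1).card

/-- The number of odd entries of `d` that are larger than `1`, counted with multiplicity. -/
def multOdd {n : ℕ} (d : Fin n → ℕ) : ℕ :=
  (Finset.univ.filter fun i => 1 < d i ∧ Odd (d i)).card

/-- The bridge parameter `β` of `d`. -/
def bridgeParam {n : ℕ} (d : Fin n → ℕ) : ℚ :=
  max (multOne d : ℚ) (((multOne d : ℚ) + (multOdd d : ℚ)) / 2)

/-- A cactus is a connected graph in which every edge is a member of at most one cycle.
A cycle, as a subgraph, is determined by its edge set, so two cyclic walks traverse the same cycle
exactly when they have the same edges (this ignores base points and directions). -/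
structure IsCactus {V : Type*} (G : SimpleGraph V) : Prop where
  connected : G.Connected
  cycle_unique : ∀ (u v : V) (p : G.Walk u u) (q : G.Walk v v), p.IsCycle → q.IsCycle →
    ∀ e : Sym2 V, e ∈ p.edges → e ∈ q.edges → ∀ f : Sym2 V, f ∈ p.edges ↔ f ∈ q.edges

/-- A bi-cactus is a cactus that is bipartite. -/
def IsBiCactus {V : Type*} (G : SimpleGraph V) : Prop :=
  IsCactus G ∧ G.IsBipartite

open Classical in
/-- The graph `G` realizes `d`: the `i`-th vertex has degree `d i`. -/
def Realizes {n : ℕ} (G : SimpleGraph (Fin n)) (d : Fin n → ℕ) : Prop :=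
  ∀ i, G.degree i = d i

end BiCactus

namespace BiCactus

open SimpleGraph

variable {V : Type*}

/-! Put `b = 4(n - 1) - 3m`. Since `m` is an integer, the floor inequality says exactly that
`multOne d ≤ b` and `multOne d + multOdd d ≤ 2b`.

Necessity. In a bi-cactus the non-bridge edges split into cycles of length at least 4. Removing one
edge from each cycle leaves a forest with at most `n - 1` edges, so there are at most `b` bridges
(`IsBiCactus.card_edgeFinset_le`). At any vertex the non-bridge edges come in pairs, two for each
cycle, so every odd vertex lies on a bridge. A bridge has two ends, and for `n ≥ 3` at most one of
them is a leaf. This gives both inequalities.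

Sufficiency. One looks for a graph whose cycles are all 4-cycles, so that it has exactly `b`
bridges. The conditions in `Admissible` are the two inequalities, the edge bound for connectedness,
and the demand that a bridge forces an odd vertex. Induction on the number of vertices
(`Admissible.realizable`) either removes a leaf, lowering `b` by one, or, when there are no leaves,
removes three degree-2 vertices to be hung as a 4-cycle at a vertex of larger degree, keeping `b`.
The graph is rebuilt by `Realizable.attach_leaf` and `Realizable.attach_fourCycle`. -/

/-- A bi-cactus living on the finite set `S` of vertices; the other vertices are isolated. -/
structure IsBiCactusOn (G : SimpleGraph V) (S : Finset V) : Prop where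
  mem : ∀ x y, G.Adj x y → x ∈ S
  reach : ∀ x ∈ S, ∀ y ∈ S, G.Reachable x y
  color : ∃ c : V → Bool, ∀ x y, G.Adj x y → c x ≠ c y
  cycle_unique : ∀ (u v : V) (p : G.Walk u u) (q : G.Walk v v), p.IsCycle → q.IsCycle →
    ∀ e : Sym2 V, e ∈ p.edges → e ∈ q.edges → ∀ f : Sym2 V, f ∈ p.edges ↔ f ∈ q.edges

theorem IsBiCactusOn.isBiCactus [Fintype V] [Nonempty V] {G : SimpleGraph V}
    (h : IsBiCactusOn G Finset.univ) : IsBiCactus G := by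
  refine ⟨⟨⟨fun x y => h.reach x (Finset.mem_univ x) y (Finset.mem_univ y)⟩, h.cycle_unique⟩, ?_⟩
  obtain ⟨c, hc⟩ := h.color
  exact ⟨recolorOfEquiv G finTwoEquiv.symm (Coloring.mk c fun {x y} hxy => hc x y hxy)⟩

theorem isBiCactusOn_singleton (v : V) : IsBiCactusOn (⊥ : SimpleGraph V) {v} where
  mem x y h := by simp at h
  reach x hx y hy := by
    rw [Finset.mem_singleton] at hx hy
    subst hx hy
    rfl
  color := ⟨fun _ => true, by simp⟩
  cycle_unique u w p q hp := (isAcyclic_bot p hp).elim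

/-! ### Local structure of cycles. -/

section Cycle

variable {G H : SimpleGraph V}

theorem IsCycle.ncard_setOf_mem_edges {u v : V} {p : G.Walk u u} (hp : p.IsCycle)
    (hv : v ∈ p.support) : {w | s(v, w) ∈ p.edges}.ncard = 2 := by
  rw [← hp.ncard_neighborSet_toSubgraph_eq_two hv]
  congr 1
  ext w
  simp [Walk.adj_toSubgraph_iff_mem_edges]

/-- On a cycle through a vertex with only two neighbours, both of them are used. -/
theorem IsCycle.mem_edges_of_neighbors {u v x y : V} {p : G.Walk u u} (hp : p.IsCycle)
    (hv : v ∈ p.support) (h : ∀ w, s(v, w) ∈ p.edges → w = x ∨ w = y) :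
    s(v, x) ∈ p.edges ∧ s(v, y) ∈ p.edges := by
  have h2 := IsCycle.ncard_setOf_mem_edges hp hv
  have hsub : {w | s(v, w) ∈ p.edges} ⊆ {x, y} := fun w hw => by simpa using h w hw
  have heq : {w | s(v, w) ∈ p.edges} = {x, y} := by
    refine Set.eq_of_subset_of_ncard_le hsub ?_ (Set.toFinite _)
    rw [h2]
    exact (Set.ncard_insert_le _ _).trans (by simp)
  exact ⟨heq.ge (Set.mem_insert x {y}), heq.ge (Set.mem_insert_of_mem x rfl)⟩

theorem IsCycle.eq_or_eq_of_mem_edges {u v w x y : V} {p : G.Walk u u} (hp : p.IsCycle)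
    (hxy : x ≠ y) (hx : s(v, x) ∈ p.edges) (hy : s(v, y) ∈ p.edges) (hw : s(v, w) ∈ p.edges) :
    w = x ∨ w = y := by
  have h2 := IsCycle.ncard_setOf_mem_edges hp (p.fst_mem_support_of_mem_edges hx)
  have hsub : {x, y} ⊆ {w | s(v, w) ∈ p.edges} := by
    rintro z (rfl | rfl)
    exacts [hx, hy]
  have heq : {x, y} = {w | s(v, w) ∈ p.edges} := by
    refine Set.eq_of_subset_of_ncard_le hsub ?_ (Set.finite_of_ncard_ne_zero (by omega))
    rw [h2, Set.ncard_pair hxy]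
  have : w ∈ ({x, y} : Set V) := heq ▸ hw
  simpa using this

theorem Walk.mem_of_closed {E : Set (Sym2 V)} {T : Set V}
    (hT : ∀ x ∈ T, ∀ y, s(x, y) ∈ E → y ∈ T) {u w : V} (p : G.Walk u w) (hu : u ∈ T)
    (hE : ∀ e ∈ p.edges, e ∈ E) : ∀ x ∈ p.support, x ∈ T := by
  induction p with
  | nil => simpa using hu
  | cons h p ih =>
    simp only [Walk.edges_cons, List.mem_cons, forall_eq_or_imp] at hE
    simp only [Walk.support_cons, List.mem_cons, forall_eq_or_imp]
    exact ⟨hu, ih (hT _ hu _ hE.1) hE.2⟩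

/-- Rotating the cycle makes it start at a vertex of `T`, which it then never leaves. -/
theorem IsCycle.mem_of_closed {u v : V} {p : G.Walk u u} {T : Set V}
    (hv : v ∈ p.support) (hvT : v ∈ T) (hT : ∀ x ∈ T, ∀ y, s(x, y) ∈ p.edges → y ∈ T) :
    ∀ x ∈ p.support, x ∈ T := by
  classical
  intro x hx
  refine Walk.mem_of_closed (E := {e | e ∈ p.edges}) hT (p.rotate v hv) hvT ?_ x ?_
  · intro e he
    exact (p.rotate_edges v hv).mem_iff.1 he
  · exact (Walk.mem_support_rotate_iff p v hv).2 hx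

/-- If the edges of `H` that are not in `G` make up a single cycle shape, then uniqueness of cycles
passes from `G` to `H`. -/
theorem cycle_unique_of_new_edges {E : Set (Sym2 V)}
    (hG : ∀ (u v : V) (p : G.Walk u u) (q : G.Walk v v), p.IsCycle → q.IsCycle →
      ∀ e : Sym2 V, e ∈ p.edges → e ∈ q.edges → ∀ f : Sym2 V, f ∈ p.edges ↔ f ∈ q.edges)
    (hnew : ∀ e ∈ E, e ∉ G.edgeSet) (hH : ∀ e ∈ H.edgeSet, e ∈ G.edgeSet ∨ e ∈ E)
    (hE : ∀ (u : V) (p : H.Walk u u), p.IsCycle → ∀ e ∈ E, e ∈ p.edges → ∀ f, f ∈ p.edges ↔ f ∈ E)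
    (u v : V) (p : H.Walk u u) (q : H.Walk v v) (hp : p.IsCycle) (hq : q.IsCycle)
    (e : Sym2 V) (hep : e ∈ p.edges) (heq : e ∈ q.edges) (f : Sym2 V) :
    f ∈ p.edges ↔ f ∈ q.edges := by
  have key : ∀ (u : V) (p : H.Walk u u), p.IsCycle →
      (∀ f, f ∈ p.edges ↔ f ∈ E) ∨ ∀ f ∈ p.edges, f ∈ G.edgeSet := by
    intro u p hp
    by_cases h : ∃ e ∈ E, e ∈ p.edges
    · obtain ⟨e, he, hep⟩ := h
      exact Or.inl (hE u p hp e he hep)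
    · push Not at h
      exact Or.inr fun f hf =>
        (hH f (p.edges_subset_edgeSet hf)).resolve_right fun hfE => h f hfE hf
  rcases key u p hp with hp' | hp' <;> rcases key v q hq with hq' | hq'
  · rw [hp', hq']
  · exact (hnew e ((hp' e).1 hep) (hq' e heq)).elim
  · exact (hnew e ((hq' e).1 heq) (hp' e hep)).elim
  · have := hG u v (p.transfer G hp') (q.transfer G hq') (hp.transfer hp') (hq.transfer hq') e
      (by simpa using hep) (by simpa using heq) f
    simpa using this

end Cycle

/-! ### Gluing a pendant edge or a 4-cycle to a bi-cactus. -/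

section Attach

variable {G : SimpleGraph V} {S : Finset V} [DecidableEq V]

/-- The new vertex has a single neighbour, so no cycle uses the new edge. -/
theorem isBiCactusOn_sup_edge {v w : V} (h : IsBiCactusOn G S) (hv : v ∈ S) (hw : w ∉ S) :
    IsBiCactusOn (G ⊔ edge v w) (insert w S) := by
  have hvw : v ≠ w := fun h => hw (h ▸ hv)
  have hGw : ∀ x, ¬ G.Adj w x := fun x hx => hw (h.mem w x hx)
  have hGw' : ∀ x, ¬ G.Adj x w := fun x hx => hGw x hx.symm
  refine ⟨?_, ?_, ?_, ?_⟩
  · intro x y hxy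
    have := h.mem x y
    grind
  · have hub : ∀ x ∈ insert w S, (G ⊔ edge v w).Reachable v x := by
      intro x hx
      rcases Finset.mem_insert.1 hx with rfl | hx
      · exact Adj.reachable (by grind)
      · exact (h.reach v hv x hx).mono le_sup_left
    exact fun x hx y hy => (hub x hx).symm.trans (hub y hy)
  · obtain ⟨c, hc⟩ := h.color
    refine ⟨Function.update c w (!c v), fun x y hxy => ?_⟩
    have hwx := hGw x
    have hwy := hGw y
    have := hc x y
    grind [Function.update_apply, adj_comm]
  · refine cycle_unique_of_new_edges (E := {s(v, w)}) h.cycle_unique ?_ ?_ ?_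
    · rintro e rfl
      exact hGw' v
    · rintro ⟨x, y⟩ hxy
      have hxy' : (G ⊔ edge v w).Adj x y := hxy
      rw [sup_adj, edge_adj] at hxy'
      rcases hxy' with hxy' | hxy'
      · exact Or.inl hxy'
      · exact Or.inr (by simpa using hxy'.1)
    · rintro u p hp e rfl he
      have := IsCycle.ncard_setOf_mem_edges hp (p.snd_mem_support_of_mem_edges he)
      have hle : {x | s(w, x) ∈ p.edges} ⊆ {v} := by
        intro x hx
        have hx' : (G ⊔ edge v w).Adj w x := p.adj_of_mem_edges hx
        have := hGw x
        rw [Set.mem_singleton_iff]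
        grind
      have := Set.ncard_le_ncard hle
      rw [Set.ncard_singleton] at this
      omega

/-- The edges of a 4-cycle. -/
def fourCycle (v a b c : V) : Set (Sym2 V) := {s(v, a), s(a, b), s(b, c), s(c, v)}

/-- The vertices `a`, `b`, `c` have only two neighbours each, so a cycle using one new edge passes
through all three and uses all four new edges. Both its edges at `v` are then new, so it cannot
continue into `G`. -/
theorem isBiCactusOn_sup_fourCycle {v a b c : V} (h : IsBiCactusOn G S) (hv : v ∈ S) (ha : a ∉ S)
    (hb : b ∉ S) (hc : c ∉ S) (hab : a ≠ b) (hac : a ≠ c) (hbc : b ≠ c) :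
    IsBiCactusOn (G ⊔ fromEdgeSet (fourCycle v a b c)) (insert a (insert b (insert c S))) := by
  have hva : v ≠ a := fun h => ha (h ▸ hv)
  have hvb : v ≠ b := fun h => hb (h ▸ hv)
  have hvc : v ≠ c := fun h => hc (h ▸ hv)
  have hGa : ∀ x, ¬ G.Adj a x := fun x hx => ha (h.mem a x hx)
  have hGb : ∀ x, ¬ G.Adj b x := fun x hx => hb (h.mem b x hx)
  have hGc : ∀ x, ¬ G.Adj c x := fun x hx => hc (h.mem c x hx)
  set H := G ⊔ fromEdgeSet (fourCycle v a b c) with hH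
  have adj : ∀ x y, H.Adj x y ↔ G.Adj x y ∨ (x = v ∧ y = a ∨ x = a ∧ y = v) ∨
      (x = a ∧ y = b ∨ x = b ∧ y = a) ∨ (x = b ∧ y = c ∨ x = c ∧ y = b) ∨
      (x = c ∧ y = v ∨ x = v ∧ y = c) := by
    intro x y
    simp only [hH, fourCycle, sup_adj, fromEdgeSet_adj, Set.mem_insert_iff,
      Set.mem_singleton_iff, Sym2.eq_iff]
    grind
  have adja : ∀ x, H.Adj a x → x = v ∨ x = b := by
    intro x hx
    have := hGa x
    grind
  have adjb : ∀ x, H.Adj b x → x = a ∨ x = c := by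
    intro x hx
    have := hGb x
    grind
  have adjc : ∀ x, H.Adj c x → x = b ∨ x = v := by
    intro x hx
    have := hGc x
    grind
  refine ⟨?_, ?_, ?_, ?_⟩
  · intro x y hxy
    have := h.mem x y
    grind
  · have ra : H.Reachable v a := Adj.reachable (by grind)
    have rb : H.Reachable a b := Adj.reachable (by grind)
    have rc : H.Reachable b c := Adj.reachable (by grind)
    have hub : ∀ x ∈ insert a (insert b (insert c S)), H.Reachable v x := by
      intro x hx
      simp only [Finset.mem_insert] at hx
      rcases hx with rfl | rfl | rfl | hx
      · exact ra
      · exact ra.trans rb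
      · exact (ra.trans rb).trans rc
      · exact (h.reach v hv x hx).mono le_sup_left
    exact fun x hx y hy => (hub x hx).symm.trans (hub y hy)
  · obtain ⟨k, hk⟩ := h.color
    refine ⟨fun x => if x = a then !k v else if x = b then k v else if x = c then !k v else k x,
      fun x y hxy => ?_⟩
    have := hGa x
    have := hGa y
    have := hGb x
    have := hGb y
    have := hGc x
    have := hGc y
    have := hk x y
    have := G.adj_comm x y
    grind
  · refine cycle_unique_of_new_edges (E := fourCycle v a b c) h.cycle_unique ?_ ?_ ?_
    · rintro e (rfl | rfl | rfl | rfl)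
      · exact fun hx => hGa v (G.adj_symm hx)
      · exact hGa b
      · exact hGb c
      · exact hGc v
    · intro e he
      rw [hH, edgeSet_sup, edgeSet_fromEdgeSet] at he
      exact he.imp id fun h => h.1
    · intro u p hp e he hep
      have ea : a ∈ p.support → s(a, v) ∈ p.edges ∧ s(a, b) ∈ p.edges := fun h =>
        IsCycle.mem_edges_of_neighbors hp h fun w hw => adja w (p.adj_of_mem_edges hw)
      have eb : b ∈ p.support → s(b, a) ∈ p.edges ∧ s(b, c) ∈ p.edges := fun h =>
        IsCycle.mem_edges_of_neighbors hp h fun w hw => adjb w (p.adj_of_mem_edges hw)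
      have ec : c ∈ p.support → s(c, b) ∈ p.edges ∧ s(c, v) ∈ p.edges := fun h =>
        IsCycle.mem_edges_of_neighbors hp h fun w hw => adjc w (p.adj_of_mem_edges hw)
      have ab : a ∈ p.support → b ∈ p.support := fun h => p.snd_mem_support_of_mem_edges (ea h).2
      have ba : b ∈ p.support → a ∈ p.support := fun h => p.snd_mem_support_of_mem_edges (eb h).1
      have bc : b ∈ p.support → c ∈ p.support := fun h => p.snd_mem_support_of_mem_edges (eb h).2
      have cb : c ∈ p.support → b ∈ p.support := fun h => p.snd_mem_support_of_mem_edges (ec h).1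
      have hpa : a ∈ p.support := by
        rcases he with rfl | rfl | rfl | rfl
        · exact p.snd_mem_support_of_mem_edges hep
        · exact p.fst_mem_support_of_mem_edges hep
        · exact ba (p.fst_mem_support_of_mem_edges hep)
        · exact ba (cb (p.fst_mem_support_of_mem_edges hep))
      obtain ⟨hav, hab'⟩ := ea hpa
      obtain ⟨hba, hbc'⟩ := eb (ab hpa)
      obtain ⟨hcb, hcv⟩ := ec (bc (ab hpa))
      have adjv : ∀ x, s(v, x) ∈ p.edges → x = a ∨ x = c := fun x hx =>
        IsCycle.eq_or_eq_of_mem_edges hp hac (by rwa [Sym2.eq_swap]) (by rwa [Sym2.eq_swap]) hx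
      have hT := IsCycle.mem_of_closed (T := {v, a, b, c}) hpa (by simp) (by
        intro x hx y hy
        have hxy : H.Adj x y := p.adj_of_mem_edges hy
        simp only [Set.mem_insert_iff, Set.mem_singleton_iff] at hx ⊢
        rcases hx with rfl | rfl | rfl | rfl
        · rcases adjv y hy with h | h <;> simp [h]
        · rcases adja y hxy with h | h <;> simp [h]
        · rcases adjb y hxy with h | h <;> simp [h]
        · rcases adjc y hxy with h | h <;> simp [h])
      rintro ⟨x, y⟩
      constructor
      · intro hxy
        have hxy' : s(x, y) ∈ p.edges := hxy
        have hadj : H.Adj x y := p.adj_of_mem_edges hxy'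
        have hx := hT x (p.fst_mem_support_of_mem_edges hxy')
        change s(x, y) ∈ _
        simp only [Set.mem_insert_iff, Set.mem_singleton_iff] at hx
        simp only [fourCycle, Set.mem_insert_iff, Set.mem_singleton_iff, Sym2.eq_iff]
        rcases hx with rfl | rfl | rfl | rfl
        · rcases adjv y hxy' with h | h <;> simp [h]
        · rcases adja y hadj with h | h <;> simp [h]
        · rcases adjb y hadj with h | h <;> simp [h]
        · rcases adjc y hadj with h | h <;> simp [h]
      · rintro (h | h | h | h) <;> rw [h]
        · rwa [Sym2.eq_swap]
        · exact hab'
        · exact hbc'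
        · exact hcv

end Attach

/-! ### Effect of the two gluings on degrees. -/

section Realizable

variable {V : Type*}

/-- Some bi-cactus on the vertices in `S` has degrees `d`. -/
def Realizable (S : Finset V) (d : V → ℕ) : Prop :=
  ∃ G : SimpleGraph V, IsBiCactusOn G S ∧ ∀ v ∈ S, (G.neighborSet v).ncard = d v

theorem realizable_singleton {v : V} {d : V → ℕ} (h : d v = 0) : Realizable {v} d := by
  refine ⟨⊥, isBiCactusOn_singleton v, fun u hu => ?_⟩
  rw [Finset.mem_singleton.1 hu, h]
  simp [neighborSet]

theorem Realizable.attach_leaf [Finite V] [DecidableEq V] {S : Finset V} {d : V → ℕ} {v w : V} (hv : v ∈ S) (hw : w ∈ S)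
    (hvw : v ≠ w) (hdw : d w = 1) (hdv : 1 ≤ d v)
    (h : Realizable (S.erase w) (Function.update d v (d v - 1))) : Realizable S d := by
  obtain ⟨G, hG, hd⟩ := h
  have hvS : v ∈ S.erase w := Finset.mem_erase.2 ⟨hvw, hv⟩
  have hGw : ∀ x, ¬ G.Adj w x := fun x hx => Finset.notMem_erase w S (hG.mem w x hx)
  have hGw' : ∀ x, ¬ G.Adj x w := fun x hx => hGw x hx.symm
  refine ⟨G ⊔ edge v w, ?_, fun u hu => ?_⟩
  · have := isBiCactusOn_sup_edge hG hvS (Finset.notMem_erase w S)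
    rwa [Finset.insert_erase hw] at this
  · rcases eq_or_ne u w with rfl | huw
    · have : (G ⊔ edge v u).neighborSet u = {v} := by
        ext x
        have := hGw x
        simp only [mem_neighborSet, Set.mem_singleton_iff]
        grind
      rw [this, Set.ncard_singleton, hdw]
    · have hdu := hd u (Finset.mem_erase.2 ⟨huw, hu⟩)
      rcases eq_or_ne u v with rfl | huv
      · have : (G ⊔ edge u w).neighborSet u = insert w (G.neighborSet u) := by
          ext x
          simp only [mem_neighborSet, Set.mem_insert_iff]
          grind
        have hwn : w ∉ G.neighborSet u := hGw' u
        rw [this, Set.ncard_insert_of_notMem hwn, hdu, Function.update_self]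
        omega
      · have : (G ⊔ edge v w).neighborSet u = G.neighborSet u := by
          ext x
          simp only [mem_neighborSet]
          grind
        rw [this, hdu, Function.update_of_ne huv]

theorem Realizable.attach_fourCycle [Finite V] [DecidableEq V] {S : Finset V} {d : V → ℕ} {v a b c : V} (hv : v ∈ S)
    (ha : a ∈ S) (hb : b ∈ S) (hc : c ∈ S) (hva : v ≠ a) (hvb : v ≠ b) (hvc : v ≠ c)
    (hab : a ≠ b) (hac : a ≠ c) (hbc : b ≠ c) (hda : d a = 2) (hdb : d b = 2) (hdc : d c = 2)
    (hdv : 2 ≤ d v)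
    (h : Realizable (((S.erase a).erase b).erase c) (Function.update d v (d v - 2))) :
    Realizable S d := by
  obtain ⟨G, hG, hd⟩ := h
  set S' := ((S.erase a).erase b).erase c with hS'
  have haS : a ∉ S' := by simp [hS']
  have hbS : b ∉ S' := by simp [hS']
  have hcS : c ∉ S' := by simp [hS']
  have hvS : v ∈ S' := by simp [*]
  have hGa : ∀ x, ¬ G.Adj a x := fun x hx => haS (hG.mem a x hx)
  have hGb : ∀ x, ¬ G.Adj b x := fun x hx => hbS (hG.mem b x hx)
  have hGc : ∀ x, ¬ G.Adj c x := fun x hx => hcS (hG.mem c x hx)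
  have hins : insert a (insert b (insert c S')) = S := by
    rw [hS', Finset.insert_erase (by simp [*, Ne.symm]), Finset.insert_erase (by simp [*, Ne.symm]),
      Finset.insert_erase ha]
  have hH := isBiCactusOn_sup_fourCycle hG hvS haS hbS hcS hab hac hbc
  rw [hins] at hH
  refine ⟨_, hH, fun u hu => ?_⟩
  set H := G ⊔ fromEdgeSet (fourCycle v a b c) with hH
  have adj : ∀ x y, H.Adj x y ↔ G.Adj x y ∨ (x = v ∧ y = a ∨ x = a ∧ y = v) ∨
      (x = a ∧ y = b ∨ x = b ∧ y = a) ∨ (x = b ∧ y = c ∨ x = c ∧ y = b) ∨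
      (x = c ∧ y = v ∨ x = v ∧ y = c) := by
    intro x y
    simp only [hH, fourCycle, sup_adj, fromEdgeSet_adj, Set.mem_insert_iff,
      Set.mem_singleton_iff, Sym2.eq_iff]
    grind
  by_cases hua : u = a
  · subst hua
    have : H.neighborSet u = {v, b} := by
      ext x
      have := hGa x
      simp only [mem_neighborSet, Set.mem_insert_iff, Set.mem_singleton_iff]
      grind
    rw [this, Set.ncard_pair hvb, hda]
  by_cases hub : u = b
  · subst hub
    have : H.neighborSet u = {a, c} := by
      ext x
      have := hGb x
      simp only [mem_neighborSet, Set.mem_insert_iff, Set.mem_singleton_iff]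
      grind
    rw [this, Set.ncard_pair hac, hdb]
  by_cases huc : u = c
  · subst huc
    have : H.neighborSet u = {v, b} := by
      ext x
      have := hGc x
      simp only [mem_neighborSet, Set.mem_insert_iff, Set.mem_singleton_iff]
      grind
    rw [this, Set.ncard_pair hvb, hdc]
  have hdu := hd u (by simp [*])
  by_cases huv : u = v
  · subst huv
    have : H.neighborSet u = insert a (insert c (G.neighborSet u)) := by
      ext x
      simp only [mem_neighborSet, Set.mem_insert_iff]
      grind
    have h1 : c ∉ G.neighborSet u := fun h => hGc u h.symm
    have h2 : a ∉ insert c (G.neighborSet u) := by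
      rintro (h | h)
      · exact hac h
      · exact hGa u (G.adj_symm h)
    rw [this, Set.ncard_insert_of_notMem h2, Set.ncard_insert_of_notMem h1, hdu,
      Function.update_self]
    omega
  · have : H.neighborSet u = G.neighborSet u := by
      ext x
      simp only [mem_neighborSet]
      grind
    rw [this, hdu, Function.update_of_ne huv]

end Realizable

/-! ### The numerical conditions and degree counts. -/

section Admissible

variable {V : Type*}

/-- The number of vertices in `S` whose degree has the property `P`. -/
def countDeg (P : ℕ → Prop) [DecidablePred P] (S : Finset V) (d : V → ℕ) : ℕ :=
  ∑ i ∈ S, if P (d i) then 1 else 0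

/-- The degrees `d` on `S` satisfy the numerical conditions for being realized by a connected graph
with `m` edges whose blocks are `4 * (#S - 1) - 3 * m` bridges and otherwise 4-cycles. -/
structure Admissible (S : Finset V) (d : V → ℕ) (m : ℕ) : Prop where
  three_le : 3 ≤ S.card
  pos : ∀ i ∈ S, 1 ≤ d i
  sum_eq : ∑ i ∈ S, d i = 2 * m
  card_le : S.card ≤ m + 1
  leaves_le : 3 * m + countDeg (· = 1) S d + 4 ≤ 4 * S.card
  odd_le : 6 * m + (countDeg (· = 1) S d + countDeg (fun k => 1 < k ∧ Odd k) S d) + 8 ≤ 8 * S.card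
  odd_pos : 3 * m + 4 < 4 * S.card →
    0 < countDeg (· = 1) S d + countDeg (fun k => 1 < k ∧ Odd k) S d

theorem sum_erase_update [DecidableEq V] {S : Finset V} (f : ℕ → ℕ) (d : V → ℕ) {v w : V} (hv : v ∈ S) (hw : w ∈ S)
    (hvw : v ≠ w) (k : ℕ) :
    ∑ i ∈ S.erase w, f (Function.update d v k i) + f (d v) + f (d w) =
      ∑ i ∈ S, f (d i) + f k := by
  have hvS : v ∈ S.erase w := Finset.mem_erase.2 ⟨hvw, hv⟩
  rw [← Finset.add_sum_erase S _ hw, ← Finset.add_sum_erase _ (fun i => f (d i)) hvS,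
    ← Finset.add_sum_erase _ (fun i => f (Function.update d v k i)) hvS, Function.update_self,
    Finset.sum_congr rfl (g := fun i => f (d i)) (s₂ := (S.erase w).erase v)]
  · ring
  · intro x hx
    rw [Function.update_of_ne (Finset.ne_of_mem_erase hx)]

theorem sum_erase_three_update [DecidableEq V] {S : Finset V} (f : ℕ → ℕ) (d : V → ℕ) {v a b c : V} (hv : v ∈ S)
    (ha : a ∈ S) (hb : b ∈ S) (hc : c ∈ S) (hva : v ≠ a) (hvb : v ≠ b) (hvc : v ≠ c)
    (hab : a ≠ b) (hac : a ≠ c) (hbc : b ≠ c) (k : ℕ) :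
    ∑ i ∈ ((S.erase a).erase b).erase c, f (Function.update d v k i) +
      f (d v) + f (d a) + f (d b) + f (d c) = ∑ i ∈ S, f (d i) + f k := by
  have := sum_erase_update (S := (S.erase a).erase b) f d (v := v) (w := c)
    (by simp [*]) (by simp [*, Ne.symm]) hvc k
  rw [← Finset.add_sum_erase S _ ha, ← Finset.add_sum_erase (S.erase a) _ (a := b) (by
    simp [*, Ne.symm])]
  omega

theorem exists_of_countDeg_pos {P : ℕ → Prop} [DecidablePred P] {S : Finset V} {d : V → ℕ}
    (h : 0 < countDeg P S d) : ∃ v ∈ S, P (d v) := by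
  rw [countDeg, ← Finset.card_filter, Finset.card_pos] at h
  obtain ⟨v, hv⟩ := h
  exact ⟨v, Finset.mem_filter.1 hv⟩

/-- Splitting degrees into 1, 2, odd above 1 and even above 3 turns the later existence claims into
linear arithmetic in four counts. -/
theorem card_eq_countDeg {S : Finset V} {d : V → ℕ} (hpos : ∀ i ∈ S, 1 ≤ d i) :
    S.card = countDeg (· = 1) S d + countDeg (· = 2) S d +
      countDeg (fun k => 1 < k ∧ Odd k) S d + countDeg (fun k => 3 < k ∧ Even k) S d := by
  simp only [countDeg, ← Finset.sum_add_distrib, Finset.card_eq_sum_ones]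
  refine Finset.sum_congr rfl fun i hi => ?_
  have := hpos i hi
  grind

theorem countDeg_le_sum {S : Finset V} {d : V → ℕ} (hpos : ∀ i ∈ S, 1 ≤ d i) :
    countDeg (· = 1) S d + 2 * countDeg (· = 2) S d +
      3 * countDeg (fun k => 1 < k ∧ Odd k) S d + 4 * countDeg (fun k => 3 < k ∧ Even k) S d ≤
      ∑ i ∈ S, d i := by
  simp only [countDeg, ← Finset.sum_add_distrib, Finset.mul_sum]
  refine Finset.sum_le_sum fun i hi => ?_
  have := hpos i hi
  grind

theorem sum_eq_countDeg {S : Finset V} {d : V → ℕ} (hpos : ∀ i ∈ S, 1 ≤ d i)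
    (ho : countDeg (fun k => 1 < k ∧ Odd k) S d = 0)
    (he : countDeg (fun k => 3 < k ∧ Even k) S d = 0) :
    ∑ i ∈ S, d i = countDeg (· = 1) S d + 2 * countDeg (· = 2) S d := by
  simp only [countDeg, Finset.sum_eq_zero_iff] at ho he
  simp only [countDeg, ← Finset.sum_add_distrib, Finset.mul_sum]
  refine Finset.sum_congr rfl fun i hi => ?_
  have := hpos i hi
  have := ho i hi
  have := he i hi
  grind

/-- The handshake parity in additive form, suited to linear arithmetic. -/
theorem exists_sum_eq_odd_add {S : Finset V} {d : V → ℕ} :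
    ∃ k, ∑ i ∈ S, d i =
      countDeg (· = 1) S d + countDeg (fun k => 1 < k ∧ Odd k) S d + 2 * k := by
  refine ⟨∑ i ∈ S, d i / 2, ?_⟩
  simp only [countDeg, ← Finset.sum_add_distrib, Finset.mul_sum]
  refine Finset.sum_congr rfl fun i hi => ?_
  grind

end Admissible

/-! ### Sufficiency: reducing admissible degrees. -/

section Existence

variable {V : Type*} {S : Finset V} {d : V → ℕ} {m : ℕ}

/-- Removing a leaf lowers `b = 4(#S - 1) - 3m` by one. The alternatives in `H` state the slack
needed afterwards: if `d v = 2`, a new leaf replaces the old one; if `d v` is even and larger, the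
number of odd vertices is unchanged; if `d v` is odd, two odd vertices disappear, and one must
survive unless `b` drops to 0. -/
theorem Admissible.erase_leaf [DecidableEq V] (h : Admissible S d m) (hS : 4 ≤ S.card) {v w : V}
    (hv : v ∈ S) (hw : w ∈ S) (hdw : d w = 1)
    (H : (d v = 2 ∧ 3 * m + countDeg (· = 1) S d + 5 ≤ 4 * S.card ∧
        6 * m + (countDeg (· = 1) S d + countDeg (fun k => 1 < k ∧ Odd k) S d) + 10 ≤
          8 * S.card) ∨
      ((3 < d v ∧ Even (d v)) ∧
        6 * m + (countDeg (· = 1) S d + countDeg (fun k => 1 < k ∧ Odd k) S d) + 10 ≤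
          8 * S.card) ∨
      ((1 < d v ∧ Odd (d v)) ∧ (3 * m + 5 < 4 * S.card →
        2 < countDeg (· = 1) S d + countDeg (fun k => 1 < k ∧ Odd k) S d))) :
    Admissible (S.erase w) (Function.update d v (d v - 1)) (m - 1) := by
  have hvw : v ≠ w := by
    rintro rfl
    omega
  have hcard := Finset.card_erase_of_mem hw
  have hpos := h.pos
  have hsum := sum_erase_update (fun k => k) d hv hw hvw (d v - 1)
  have h1 := sum_erase_update (fun k => if k = 1 then 1 else 0) d hv hw hvw (d v - 1)
  have ho := sum_erase_update (fun k => if 1 < k ∧ Odd k then 1 else 0) d hv hw hvw (d v - 1)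
  obtain ⟨-, -, hm, hle, hl, hod, hop⟩ := h
  simp only [hdw] at hsum h1 ho
  have hv1 : 1 < d v := by omega
  have hc1 : 0 < countDeg (· = 1) S d := by
    rw [countDeg, ← Finset.card_filter, Finset.card_pos]
    exact ⟨w, Finset.mem_filter.2 ⟨hw, hdw⟩⟩
  simp only [countDeg] at hl hod hop H hc1
  have hpos' : ∀ i ∈ S.erase w, 1 ≤ Function.update d v (d v - 1) i := by
    intro i hi
    have := hpos i (Finset.mem_of_mem_erase hi)
    rw [Function.update_apply]
    split_ifs <;> omega
  rcases H with ⟨h2, Hl, Ho⟩ | ⟨hev, Ho⟩ | ⟨hod', Hp⟩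
  · rw [h2] at hsum h1 ho hpos' ⊢
    rw [if_neg (by decide), if_pos trivial, if_pos (by decide)] at h1
    rw [if_neg (by decide), if_neg (by decide)] at ho
    refine ⟨by omega, hpos', by omega, by omega, ?_, ?_, ?_⟩ <;> simp only [countDeg] <;> omega
  · have e1 : ¬ (1 < d v ∧ Odd (d v)) := fun h => Nat.not_even_iff_odd.2 h.2 hev.2
    have e2 : 1 < d v - 1 ∧ Odd (d v - 1) := by grind
    rw [if_neg (show ¬ d v = 1 by omega), if_pos trivial, if_neg (show ¬ d v - 1 = 1 by omega)] at h1
    rw [if_neg e1, if_pos e2, if_neg (by simp)] at ho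
    refine ⟨by omega, hpos', by omega, by omega, ?_, ?_, ?_⟩ <;> simp only [countDeg] <;> omega
  · have e2 : ¬ (1 < d v - 1 ∧ Odd (d v - 1)) := by grind
    have e3 : d v - 1 ≠ 1 := by grind
    rw [if_neg (show ¬ d v = 1 by omega), if_pos trivial, if_neg e3] at h1
    rw [if_pos hod', if_neg e2, if_neg (by simp)] at ho
    refine ⟨by omega, hpos', by omega, by omega, ?_, ?_, ?_⟩ <;> simp only [countDeg] <;> omega

theorem Admissible.exists_erase_leaf [DecidableEq V] (h : Admissible S d m) (hS : 4 ≤ S.card)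
    {w : V} (hw : w ∈ S) (hdw : d w = 1) :
    ∃ v ∈ S, 2 ≤ d v ∧ Admissible (S.erase w) (Function.update d v (d v - 1)) (m - 1) := by
  have hcard := card_eq_countDeg h.pos
  have hsum := countDeg_le_sum h.pos
  have hall := sum_eq_countDeg h.pos
  obtain ⟨k, hk⟩ := exists_sum_eq_odd_add (S := S) (d := d)
  have hm := h.sum_eq
  have hle := h.card_le
  have hl := h.leaves_le
  have hod := h.odd_le
  have hc1 : 0 < countDeg (· = 1) S d := by
    rw [countDeg, ← Finset.card_filter, Finset.card_pos]
    exact ⟨w, Finset.mem_filter.2 ⟨hw, hdw⟩⟩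
  -- Suppose no odd degree exceeds 1. The number of leaves is then even, so `b ≥ 2` and the bound by
  -- `2b` has slack. Either some even degree exceeds 3, or the degrees are those of a path, where `b
  -- = #S - 1 ≥ 3` exceeds the two leaves. An odd degree above 1 can be used directly unless `b ≥ 2`
  -- and there is just one leaf and one such vertex; then both bounds have slack and `#S ≥ 4`
  -- supplies a vertex of even degree.
  have key : (0 < countDeg (· = 2) S d ∧ 3 * m + countDeg (· = 1) S d + 5 ≤ 4 * S.card ∧
        6 * m + (countDeg (· = 1) S d + countDeg (fun k => 1 < k ∧ Odd k) S d) + 10 ≤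
          8 * S.card) ∨
      (0 < countDeg (fun k => 3 < k ∧ Even k) S d ∧
        6 * m + (countDeg (· = 1) S d + countDeg (fun k => 1 < k ∧ Odd k) S d) + 10 ≤
          8 * S.card) ∨
      (0 < countDeg (fun k => 1 < k ∧ Odd k) S d ∧ (3 * m + 5 < 4 * S.card →
        2 < countDeg (· = 1) S d + countDeg (fun k => 1 < k ∧ Odd k) S d)) := by
    omega
  rcases key with ⟨hp, H⟩ | ⟨hp, H⟩ | ⟨hp, H⟩ <;> obtain ⟨v, hv, hPv⟩ := exists_of_countDeg_pos hp
  · exact ⟨v, hv, by omega, h.erase_leaf hS hv hw hdw (Or.inl ⟨hPv, H⟩)⟩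
  · exact ⟨v, hv, by omega, h.erase_leaf hS hv hw hdw (Or.inr (Or.inl ⟨hPv, H⟩))⟩
  · exact ⟨v, hv, by omega, h.erase_leaf hS hv hw hdw (Or.inr (Or.inr ⟨hPv, H⟩))⟩

/-- Three vertices and four edges go, so `b` is unchanged, and subtracting 2 at `v` preserves
parity. -/
theorem Admissible.erase_fourCycle [DecidableEq V] (h : Admissible S d m)
    (h1 : countDeg (· = 1) S d = 0) {v a b c : V} (hv : v ∈ S)
    (ha : a ∈ S) (hb : b ∈ S) (hc : c ∈ S) (hab : a ≠ b) (hac : a ≠ c) (hbc : b ≠ c)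
    (hda : d a = 2) (hdb : d b = 2) (hdc : d c = 2) (hdv : 3 ≤ d v) :
    Admissible (((S.erase a).erase b).erase c) (Function.update d v (d v - 2)) (m - 4) := by
  have hva : v ≠ a := by rintro rfl; omega
  have hvb : v ≠ b := by rintro rfl; omega
  have hvc : v ≠ c := by rintro rfl; omega
  have hcard := Finset.card_erase_of_mem ha
  have hcard1 := Finset.card_erase_of_mem (Finset.mem_erase.2 ⟨hab.symm, hb⟩)
  have hcard2 := Finset.card_erase_of_mem
    (Finset.mem_erase.2 ⟨hbc.symm, Finset.mem_erase.2 ⟨hac.symm, hc⟩⟩)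
  have hpos := h.pos
  have hS3 := h.three_le
  have hcards := card_eq_countDeg h.pos
  have hsums := countDeg_le_sum h.pos
  have hsum := sum_erase_three_update (fun k => k) d hv ha hb hc hva hvb hvc hab hac hbc (d v - 2)
  have hone := sum_erase_three_update (fun k => if k = 1 then 1 else 0) d hv ha hb hc hva hvb hvc
    hab hac hbc (d v - 2)
  have hodd := sum_erase_three_update (fun k => if 1 < k ∧ Odd k then 1 else 0) d hv ha hb hc
    hva hvb hvc hab hac hbc (d v - 2)
  obtain ⟨-, -, hm, hle, hl, hod, hop⟩ := h
  simp only [hda, hdb, hdc] at hsum hone hodd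
  -- Together with `3m + 4 ≤ 4 #S` this forces `#S ≥ 7`, so enough vertices remain.
  have hlt : S.card < m := by
    have hlt : ∑ i ∈ S, 2 < ∑ i ∈ S, d i := by
      refine Finset.sum_lt_sum (fun i hi => ?_) ⟨v, hv, by omega⟩
      have := hpos i hi
      have h0 : ∀ j ∈ S, (if d j = 1 then 1 else 0) = 0 := Finset.sum_eq_zero_iff.1 h1
      have := h0 i hi
      grind
    rw [Finset.sum_const, smul_eq_mul] at hlt
    omega
  have hpos' : ∀ i ∈ ((S.erase a).erase b).erase c, 1 ≤ Function.update d v (d v - 2) i := by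
    intro i hi
    have := hpos i (Finset.mem_of_mem_erase (Finset.mem_of_mem_erase (Finset.mem_of_mem_erase hi)))
    rw [Function.update_apply]
    split_ifs <;> omega
  rw [if_neg (show ¬ d v = 1 by omega)] at hone
  simp only [show ¬ Odd 2 by decide, and_false, if_false, OfNat.ofNat_ne_one] at hone hodd
  simp only [countDeg] at hl hod hop h1
  -- Degree 3 creates a leaf; this is allowed because the odd vertex `v` already forces `b ≥ 1`.
  by_cases h3 : d v = 3
  · rw [h3] at hpos' hsum hone hodd ⊢
    rw [if_pos (by decide), if_neg (by decide)] at hodd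
    rw [if_pos (by decide)] at hone
    refine ⟨by omega, hpos', by omega, by omega, ?_, ?_, ?_⟩ <;> simp only [countDeg] <;> omega
  · have e : (1 < d v - 2 ∧ Odd (d v - 2)) ↔ (1 < d v ∧ Odd (d v)) := by grind
    rw [if_neg (show ¬ d v - 2 = 1 by omega)] at hone
    simp only [e] at hodd
    refine ⟨by omega, hpos', by omega, by omega, ?_, ?_, ?_⟩ <;> simp only [countDeg] <;> omega

theorem exists_three_of_countDeg {P : ℕ → Prop} [DecidablePred P] (h : 3 ≤ countDeg P S d) :
    ∃ a ∈ S, ∃ b ∈ S, ∃ c ∈ S, a ≠ b ∧ a ≠ c ∧ b ≠ c ∧ P (d a) ∧ P (d b) ∧ P (d c) := by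
  rw [countDeg, ← Finset.card_filter] at h
  obtain ⟨a, ha, b, hb, c, hc, hab, hac, hbc⟩ := Finset.two_lt_card.1 h
  rw [Finset.mem_filter] at ha hb hc
  exact ⟨a, ha.1, b, hb.1, c, hc.1, hab, hac, hbc, ha.2, hb.2, hc.2⟩

/-- Admissible degrees are realized by bi-cacti. -/
theorem Admissible.realizable [Finite V] (k : ℕ) :
    ∀ (S : Finset V) (d : V → ℕ) (m : ℕ), S.card = k → Admissible S d m → Realizable S d := by
  classical
  induction k using Nat.strong_induction_on with
  | _ k ih =>
  intro S d m hk h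
  have hcard := card_eq_countDeg h.pos
  have hsum := countDeg_le_sum h.pos
  have hall := sum_eq_countDeg h.pos
  have hm := h.sum_eq
  have hle := h.card_le
  have hl := h.leaves_le
  have hod := h.odd_le
  have hop := h.odd_pos
  have h3 := h.three_le
  by_cases h1 : countDeg (· = 1) S d = 0
  -- Without leaves, the degree sum is too large for `3m + 4 ≤ 4 #S` unless many degrees equal 2.
  · have h2 : 3 ≤ countDeg (· = 2) S d := by omega
    obtain ⟨a, ha, b, hb, c, hc, hab, hac, hbc, hda, hdb, hdc⟩ := exists_three_of_countDeg h2
    by_cases hv : ∃ v ∈ S, 3 ≤ d v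
    · obtain ⟨v, hv, hdv⟩ := hv
      refine Realizable.attach_fourCycle hv ha hb hc (by rintro rfl; omega)
        (by rintro rfl; omega) (by rintro rfl; omega) hab hac hbc hda hdb hdc (by omega) ?_
      refine ih _ ?_ _ _ _ rfl (h.erase_fourCycle h1 hv ha hb hc hab hac hbc hda hdb hdc hdv)
      rw [← hk]
      exact Finset.card_lt_card (Finset.ssubset_of_subset_of_ssubset
        ((Finset.erase_subset _ _).trans (Finset.erase_subset _ _)) (Finset.erase_ssubset ha))
    · push Not at hv
      have hd2 : ∀ i ∈ S, d i = 2 := by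
        intro i hi
        have := h.pos i hi
        have h0 : ∀ j ∈ S, (if d j = 1 then 1 else 0) = 0 := Finset.sum_eq_zero_iff.1 h1
        have := h0 i hi
        have := hv i hi
        grind
      have hsum2 : ∑ i ∈ S, d i = S.card * 2 := by
        rw [Finset.sum_congr rfl hd2, Finset.sum_const, smul_eq_mul]
      have ho : countDeg (fun k => 1 < k ∧ Odd k) S d = 0 := by
        rw [countDeg, Finset.sum_eq_zero_iff]
        intro i hi
        rw [hd2 i hi]
        decide
      -- All degrees are 2, so `m = #S`; with no odd vertex, `odd_pos` forces `b = 0`, which leaves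
      -- only the 4-cycle.
      have h4 : S.card = 4 := by omega
      have hcard1 := Finset.card_erase_of_mem ha
      have hcard2 := Finset.card_erase_of_mem (Finset.mem_erase.2 ⟨hab.symm, hb⟩)
      have hcard3 := Finset.card_erase_of_mem
        (Finset.mem_erase.2 ⟨hbc.symm, Finset.mem_erase.2 ⟨hac.symm, hc⟩⟩)
      obtain ⟨v, hv'⟩ := Finset.card_eq_one.1
        (show (((S.erase a).erase b).erase c).card = 1 by omega)
      have hvS : v ∈ ((S.erase a).erase b).erase c := hv' ▸ Finset.mem_singleton_self v
      simp only [Finset.mem_erase] at hvS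
      obtain ⟨hvc, hvb, hva, hvS⟩ := hvS
      refine Realizable.attach_fourCycle hvS ha hb hc hva hvb hvc hab hac hbc hda hdb hdc
        (hd2 v hvS).ge ?_
      rw [hv', hd2 v hvS]
      exact realizable_singleton (by simp)
  · obtain ⟨w, hw, hdw⟩ := exists_of_countDeg_pos (Nat.pos_of_ne_zero h1)
    by_cases h4 : 4 ≤ S.card
    · obtain ⟨v, hv, hdv, hadm⟩ := h.exists_erase_leaf h4 hw hdw
      refine Realizable.attach_leaf hv hw (by rintro rfl; omega) hdw (by omega) ?_
      refine ih _ ?_ _ _ _ rfl hadm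
      rw [← hk]
      exact Finset.card_erase_lt_of_mem hw
    -- On three vertices only the path with degrees 1, 2, 1 is possible. It is built directly, since
    -- a single edge has two leaves on one bridge and is not admissible.
    · have hc2 : 0 < countDeg (· = 2) S d := by omega
      obtain ⟨v, hv, hdv⟩ := exists_of_countDeg_pos hc2
      have hvw : v ≠ w := by rintro rfl; omega
      have hcard1 := Finset.card_erase_of_mem hw
      have hcard2 := Finset.card_erase_of_mem (Finset.mem_erase.2 ⟨hvw, hv⟩)
      obtain ⟨x, hx⟩ := Finset.card_eq_one.1 (show ((S.erase w).erase v).card = 1 by omega)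
      have hxS : x ∈ (S.erase w).erase v := hx ▸ Finset.mem_singleton_self x
      have hx1 := Finset.add_sum_erase S d hw
      have hx2 := Finset.add_sum_erase (S.erase w) d (Finset.mem_erase.2 ⟨hvw, hv⟩)
      rw [hx, Finset.sum_singleton] at hx2
      simp only [Finset.mem_erase] at hxS
      obtain ⟨hxv, hxw, hxS⟩ := hxS
      refine Realizable.attach_leaf hv hw hvw hdw (by omega) ?_
      refine Realizable.attach_leaf (v := v) (w := x) (by simp [*]) (by simp [*]) hxv.symm ?_ ?_ ?_
      · rw [Function.update_of_ne hxv]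
        omega
      · rw [Function.update_self]
        omega
      · have : (S.erase w).erase x = {v} := by
          have hSx : S.erase w = {v, x} := by
            rw [← hx, Finset.insert_erase (Finset.mem_erase.2 ⟨hvw, hv⟩)]
          rw [hSx]
          ext y
          simp only [Finset.mem_erase, Finset.mem_insert, Finset.mem_singleton]
          grind
        rw [this]
        refine realizable_singleton ?_
        simp [hdv]

end Existence

/-! ### Necessity: counting bridges. -/

section Necessity

variable {V : Type*} {G : SimpleGraph V}

/-- The edges that share a cycle with `e`. -/
def cycleEdges (G : SimpleGraph V) (e : Sym2 V) : Set (Sym2 V) :=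
  {f | ∃ (u : V) (p : G.Walk u u), p.IsCycle ∧ e ∈ p.edges ∧ f ∈ p.edges}

theorem IsCactus.cycleEdges_eq (hG : IsCactus G) {u : V} {p : G.Walk u u} (hp : p.IsCycle)
    {e : Sym2 V} (he : e ∈ p.edges) : cycleEdges G e = {f | f ∈ p.edges} := by
  ext f
  constructor
  · rintro ⟨v, q, hq, heq, hf⟩
    exact (hG.cycle_unique u v p q hp hq e he heq f).2 hf
  · exact fun hf => ⟨u, p, hp, he, hf⟩

theorem exists_isCycle_of_not_isBridge {e : Sym2 V} (he : e ∈ G.edgeSet) (h : ¬ G.IsBridge e) :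
    ∃ (u : V) (p : G.Walk u u), p.IsCycle ∧ e ∈ p.edges := by
  rw [isBridge_iff_forall_cycle_notMem he] at h
  push Not at h
  exact h

theorem four_le_length (hG : G.IsBipartite) {u : V} {p : G.Walk u u} (hp : p.IsCycle) :
    4 ≤ p.length := by
  obtain ⟨c⟩ := hG
  have h := (Coloring.even_length_iff_congr (recolorOfEquiv G finTwoEquiv c) p).2 Iff.rfl
  have := hp.three_le_length
  obtain ⟨k, hk⟩ := h
  omega

open Classical in
theorem IsBiCactus.card_edgeFinset_le [Fintype V] (hG : IsBiCactus G) :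
    3 * G.edgeFinset.card + (G.edgeFinset.filter G.IsBridge).card + 4 ≤ 4 * Fintype.card V := by
  obtain ⟨hG, hbip⟩ := hG
  set N := G.edgeFinset.filter fun e => ¬ G.IsBridge e with hN
  have hcard : (G.edgeFinset.filter G.IsBridge).card + N.card = G.edgeFinset.card :=
    Finset.card_filter_add_card_filter_not _
  have hcyc : ∀ e ∈ N, ∃ (u : V) (p : G.Walk u u), p.IsCycle ∧ e ∈ p.edges := by
    intro e he
    rw [hN, Finset.mem_filter, mem_edgeFinset] at he
    exact exists_isCycle_of_not_isBridge he.1 he.2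
  have hmemN : ∀ (u : V) (p : G.Walk u u), p.IsCycle → ∀ e ∈ p.edges, e ∈ N := by
    intro u p hp e he
    rw [hN, Finset.mem_filter, mem_edgeFinset]
    exact ⟨p.edges_subset_edgeSet he, fun hb => hb.notMem_edges_of_isCycle hp he⟩
  -- The fibres of `cycleEdges G` on the non-bridges are the edge sets of the cycles.
  have h4 : 4 * (N.image (cycleEdges G)).card ≤ N.card := by
    refine Finset.mul_card_image_le_card N 4 fun C hC => ?_
    obtain ⟨e, he, rfl⟩ := Finset.mem_image.1 hC
    obtain ⟨u, p, hp, hep⟩ := hcyc e he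
    calc 4 ≤ p.edges.toFinset.card := by
          rw [List.toFinset_card_of_nodup hp.edges_nodup, Walk.length_edges]
          exact four_le_length hbip hp
      _ ≤ _ := by
          refine Finset.card_le_card fun f hf => ?_
          rw [List.mem_toFinset] at hf
          rw [Finset.mem_filter]
          exact ⟨hmemN u p hp f hf, by rw [hG.cycleEdges_eq hp hf, hG.cycleEdges_eq hp hep]⟩
  obtain ⟨R, hRN, hRinj, hR⟩ : ∃ R ⊆ N, Set.InjOn (cycleEdges G) R ∧
      R.image (cycleEdges G) = N.image (cycleEdges G) := by
    refine Finset.exists_subset_injOn_image_eq_of_surjOn (N : Set (Sym2 V)) _ ?_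
    rw [Finset.coe_image]
    exact Set.surjOn_image _ _
  have hRcard : R.card = (N.image (cycleEdges G)).card := by
    rw [← hR, Finset.card_image_of_injOn hRinj]
  -- `R` has one edge from each cycle, so no cycle avoids it.
  have hacyc : (G.deleteEdges (R : Set (Sym2 V))).IsAcyclic := by
    intro u p hp
    have hle : G.deleteEdges (R : Set (Sym2 V)) ≤ G := deleteEdges_le _
    have hp' := hp.mapLe hle
    obtain ⟨e, he⟩ := List.exists_mem_of_ne_nil p.edges (by
      rw [Ne, Walk.edges_eq_nil]
      exact hp.not_nil)
    have he' : e ∈ (p.mapLe hle).edges := by rwa [Walk.edges_mapLe_eq_edges]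
    have hmem : cycleEdges G e ∈ R.image (cycleEdges G) := by
      rw [hR]
      exact Finset.mem_image_of_mem _ (hmemN u _ hp' e he')
    obtain ⟨r, hr, hre⟩ := Finset.mem_image.1 hmem
    obtain ⟨v, q, hq, hrq⟩ := hcyc r (hRN hr)
    have : r ∈ cycleEdges G r := ⟨v, q, hq, hrq, hrq⟩
    rw [hre, hG.cycleEdges_eq hp' he', Set.mem_ofPred_eq, Walk.edges_mapLe_eq_edges] at this
    have := p.edges_subset_edgeSet this
    rw [edgeSet_deleteEdges] at this
    exact this.2 hr
  obtain ⟨F, hF, -, hFt⟩ := hG.connected.exists_isTree_le_of_le_of_isAcyclic (deleteEdges_le _) hacyc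
  have hFcard := hFt.card_edgeFinset
  have hle : (G.edgeFinset \ R).card ≤ F.edgeFinset.card := by
    refine Finset.card_le_card fun e he => ?_
    rw [mem_edgeFinset]
    refine edgeSet_mono hF ?_
    rw [edgeSet_deleteEdges]
    rw [Finset.mem_sdiff, mem_edgeFinset] at he
    exact he
  have := Finset.card_sdiff_add_card_eq_card (hRN.trans (Finset.filter_subset _ _))
  omega

open Classical in
theorem IsCactus.exists_isBridge_of_odd_degree [Fintype V] (hG : IsCactus G) {v : V}
    (hv : Odd (G.degree v)) : ∃ w, G.Adj v w ∧ G.IsBridge s(v, w) := by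
  by_contra! hno
  rw [← Nat.not_even_iff_odd] at hv
  apply hv
  rw [← card_neighborFinset_eq_degree,
    Finset.card_eq_sum_card_image (fun w => cycleEdges G s(v, w)) (G.neighborFinset v)]
  -- If no edge at `v` is a bridge, grouping the neighbours by the cycle of their edge gives classes
  -- of size two.
  refine Finset.even_sum _ fun C hC => ?_
  obtain ⟨w, hw, rfl⟩ := Finset.mem_image.1 hC
  rw [mem_neighborFinset] at hw
  obtain ⟨u, p, hp, hwp⟩ := exists_isCycle_of_not_isBridge (e := s(v, w)) hw (hno w hw)
  have h2 := IsCycle.ncard_setOf_mem_edges hp (p.fst_mem_support_of_mem_edges hwp)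
  have : {x | s(v, x) ∈ p.edges} =
      ((G.neighborFinset v).filter fun x => cycleEdges G s(v, x) = cycleEdges G s(v, w) :
        Finset V) := by
    ext x
    rw [Finset.mem_coe, Finset.mem_filter, mem_neighborFinset, Set.mem_ofPred_eq]
    constructor
    · exact fun hx => ⟨p.adj_of_mem_edges hx, by
        rw [hG.cycleEdges_eq hp hx, hG.cycleEdges_eq hp hwp]⟩
    · rintro ⟨hx, heq⟩
      obtain ⟨z, q, hq, hxq⟩ := exists_isCycle_of_not_isBridge (e := s(v, x)) hx (hno x hx)
      have : s(v, x) ∈ cycleEdges G s(v, x) := ⟨z, q, hq, hxq, hxq⟩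
      rwa [heq, hG.cycleEdges_eq hp hwp] at this
  rw [this, Set.ncard_coe_finset] at h2
  rw [h2]
  exact even_two

open Classical in
theorem IsCactus.card_odd_le [Fintype V] (hG : IsCactus G) :
    (Finset.univ.filter fun v => Odd (G.degree v)).card ≤
      2 * (G.edgeFinset.filter G.IsBridge).card := by
  have hsub : (Finset.univ.filter fun v => Odd (G.degree v)) ⊆
      (G.edgeFinset.filter G.IsBridge).biUnion Sym2.toFinset := by
    intro v hv
    obtain ⟨w, hw, hb⟩ := hG.exists_isBridge_of_odd_degree (Finset.mem_filter.1 hv).2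
    rw [Finset.mem_biUnion]
    exact ⟨s(v, w), Finset.mem_filter.2 ⟨mem_edgeFinset.2 hw, hb⟩, by simp⟩
  refine (Finset.card_le_card hsub).trans ?_
  rw [mul_comm]
  refine Finset.card_biUnion_le_card_mul _ _ _ fun e _ => ?_
  by_cases he : e.IsDiag
  · rw [Sym2.card_toFinset_of_isDiag e he]
    exact one_le_two
  · rw [Sym2.card_toFinset_of_not_isDiag e he]

-- Two adjacent leaves would form a whole component, cutting off any third vertex.
open Classical in
theorem not_adj_of_degree_one [Fintype V] (hG : G.Connected) (hV : 3 ≤ Fintype.card V) {v w : V}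
    (hv : G.degree v = 1) (hw : G.degree w = 1) : ¬ G.Adj v w := by
  intro hvw
  obtain ⟨a, -, ha⟩ := degree_eq_one_iff_existsUnique_adj.1 hv
  obtain ⟨b, -, hb⟩ := degree_eq_one_iff_existsUnique_adj.1 hw
  obtain ⟨x, -, hx⟩ := Finset.exists_mem_notMem_of_card_lt_card (s := {v, w})
    (t := Finset.univ) (lt_of_le_of_lt Finset.card_le_two (by rw [Finset.card_univ]; omega))
  obtain ⟨p⟩ := hG.preconnected v x
  have := Walk.mem_of_closed (E := Set.univ ∩ G.edgeSet) (T := {v, w}) (by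
    rintro y (rfl | rfl) z ⟨-, hz⟩
    · exact Or.inr ((ha z hz).trans (ha w hvw).symm)
    · exact Or.inl ((hb z hz).trans (hb v hvw.symm).symm)) p (by simp)
    (fun e he => ⟨trivial, p.edges_subset_edgeSet he⟩) x p.end_mem_support
  exact hx (by simpa using this)

-- Sending a leaf to its bridge is injective, because two leaves sharing a bridge would be adjacent.
open Classical in
theorem IsCactus.card_leaves_le [Fintype V] (hG : IsCactus G) (hV : 3 ≤ Fintype.card V) :
    (Finset.univ.filter fun v => G.degree v = 1).card ≤ (G.edgeFinset.filter G.IsBridge).card := by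
  have h : ∀ v, ∃ w, G.degree v = 1 → G.Adj v w ∧ G.IsBridge s(v, w) := by
    intro v
    by_cases hv : G.degree v = 1
    · obtain ⟨w, hw⟩ := hG.exists_isBridge_of_odd_degree (v := v) (by rw [hv]; exact odd_one)
      exact ⟨w, fun _ => hw⟩
    · exact ⟨v, fun h => absurd h hv⟩
  choose f hf using h
  refine Finset.card_le_card_of_injOn (fun v => s(v, f v)) ?_ ?_
  · intro v hv
    have hv' := hf v (Finset.mem_filter.1 hv).2
    exact Finset.mem_filter.2 ⟨mem_edgeFinset.2 hv'.1, hv'.2⟩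
  · intro v hv w hw hvw
    have hv1 := (Finset.mem_filter.1 hv).2
    have hw1 := (Finset.mem_filter.1 hw).2
    rcases Sym2.eq_iff.1 hvw with ⟨h, -⟩ | ⟨-, h⟩
    · exact h
    · exact (not_adj_of_degree_one hG.connected hV hv1 hw1 (h ▸ (hf v hv1).1)).elim

end Necessity

/-! ### Clearing the floor and the maximum, and conclusion. -/

theorem le_floor_iff (n : ℕ) (d : Fin n → ℕ) (m : ℕ) (hm : ∑ i, d i = 2 * m) :
    halfVolume d ≤ ((⌊(4 * ((n : ℚ) - 1) - bridgeParam d) / 3⌋ : ℤ) : ℚ) ↔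
      3 * m + multOne d + 4 ≤ 4 * n ∧
        6 * m + (multOne d + multOdd d) + 8 ≤ 8 * n := by
  have hvol : halfVolume d = ((m : ℤ) : ℚ) := by
    rw [halfVolume, ← Nat.cast_sum, hm]
    push_cast
    ring
  rw [hvol, Int.cast_le, Int.le_floor, le_div_iff₀ (by norm_num), le_sub_comm, bridgeParam,
    max_le_iff, ← @Nat.cast_le ℚ, ← @Nat.cast_le ℚ]
  push_cast
  constructor <;> rintro ⟨h1, h2⟩ <;> constructor <;> linarith

end BiCactus

theorem mainTheorem1 (n : ℕ) (d : Fin n → ℕ) (hd : BiCactus.IsDegreeSequence d)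
    (hn : 4 ≤ n) (h4 : 2 ≤ d ⟨3, by omega⟩)
    (hvol : 2 * n < ∑ i, d i)
    (hodd : 2 ≤ BiCactus.multOne d + BiCactus.multOdd d) :
    (∃ G : SimpleGraph (Fin n), BiCactus.IsBiCactus G ∧ BiCactus.Realizes G d) ↔
      BiCactus.halfVolume d ≤
        ((⌊(4 * ((n : ℚ) - 1) - BiCactus.bridgeParam d) / 3⌋ : ℤ) : ℚ) := by
  classical
  obtain ⟨m, hm⟩ := hd.even_sum
  rw [← two_mul] at hm
  rw [BiCactus.le_floor_iff n d m hm]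
  constructor
  · rintro ⟨G, hG, hdeg⟩
    have hdeg' : ∀ i, G.degree i = d i := fun i => by rw [← hdeg i]
    have hE : 2 * G.edgeFinset.card = 2 * m := by
      rw [← G.sum_degrees_eq_twice_card_edges, ← hm]
      exact Finset.sum_congr rfl fun i _ => hdeg' i
    have h1 := hG.card_edgeFinset_le
    have h2 := hG.1.card_odd_le
    have h3 := hG.1.card_leaves_le (by rw [Fintype.card_fin]; omega)
    simp only [hdeg', Fintype.card_fin] at h1 h2 h3
    have h5 : BiCactus.multOne d + BiCactus.multOdd d =
        (Finset.univ.filter fun v => Odd (d v)).card := by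
      simp only [BiCactus.multOne, BiCactus.multOdd, Finset.card_filter, ← Finset.sum_add_distrib]
      refine Finset.sum_congr rfl fun i _ => ?_
      have := hd.pos i
      grind
    have h6 : BiCactus.multOne d ≤ (G.edgeFinset.filter G.IsBridge).card := by
      rw [BiCactus.multOne]
      convert h3
    constructor
    · omega
    · have : (Finset.univ.filter fun v => Odd (d v)).card ≤
          2 * (G.edgeFinset.filter G.IsBridge).card := by convert h2
      omega
  · rintro ⟨h1, h2⟩
    have hone : BiCactus.countDeg (· = 1) Finset.univ d = BiCactus.multOne d := by
      rw [BiCactus.countDeg, BiCactus.multOne, Finset.card_filter]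
    have hodd' : BiCactus.countDeg (fun k => 1 < k ∧ Odd k) Finset.univ d = BiCactus.multOdd d := by
      rw [BiCactus.countDeg, BiCactus.multOdd, Finset.card_filter]
    have hadm : BiCactus.Admissible Finset.univ d m := by
      -- The volume hypothesis gives the edge bound for connectedness, and `hodd` gives the odd
      -- vertex.
      refine ⟨?_, fun i _ => hd.pos i, hm, ?_, ?_, ?_, fun _ => ?_⟩ <;>
        simp only [Finset.card_univ, Fintype.card_fin, hone, hodd'] <;> omega
    obtain ⟨G, hG, hdeg⟩ := hadm.realizable _ _ _ _ rfl
    have : Nonempty (Fin n) := ⟨⟨3, by omega⟩⟩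
    refine ⟨G, hG.isBiCactus, fun i => ?_⟩
    rw [← hdeg i (Finset.mem_univ i), ← SimpleGraph.card_neighborSet_eq_degree,
      ← Nat.card_eq_fintype_card]
    rfl
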